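/- **Frobenius' theorem.** Let $G$ be a finite group and let $H$ be a subgroup of $G$ with $1 < H < G$ such that $H \cap H^x = 1$ for every $x \in G \setminus H$, where $H^x = x^{-1}Hx$ (that is, $G$ is a Frobenius group with complement $H$). Let $n = |G:H|$. Then the Frobenius kernel $$K = \Bigl(G \setminus \bigcup_{x \in G} H^x\Bigr) \cup \{1\}$$ is a normal subgroup of $G$ of order $n$. -/

import Mathlib

/-- The conjugate subgroup `H ^ x = x⁻¹ H x`. -/
def conjSubgroup {G : Type*} [Group G] (H : Subgroup G) (x : G) : Subgroup G :=
  H.map (MulAut.conj x⁻¹).toMonoidHom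

/-- `H` is a Frobenius complement in `G`: a nontrivial proper subgroup which meets `H ^ x`
trivially for every `x` outside `H`. A finite group `G` is a Frobenius group with complement `H`
when this holds. -/
structure IsFrobeniusComplement {G : Type*} [Group G] (H : Subgroup G) : Prop where
  bot_lt : ⊥ < H
  lt_top : H < ⊤
  inf_conj_eq_bot : ∀ x : G, x ∉ H → H ⊓ conjSubgroup H x = ⊥

/-- The Frobenius kernel, as a set: the elements of `G` lying in no conjugate of `H`,
together with the identity. -/
def frobeniusKernel {G : Type*} [Group G] (H : Subgroup G) : Set G :=
  (⋃ x : G, (conjSubgroup H x : Set G))ᶜ ∪ {1}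

/-! Every irreducible character `χ` of `H`, of degree `d`, extends to a character of `G` equal to
`d` on the kernel set (`exists_extension`). Indeed `χ - d` vanishes at 1, so inducing it to `G` and
adding `d` back gives a class function `θ` extending `χ`; reciprocity makes its norm 1 and its
coefficients on irreducibles integral, and `θ 1 = d > 0` fixes the sign.

Let `N` be the intersection of the kernels of these extensions. It meets `H` trivially, since
irreducibles of `H` separate points; being normal, it avoids nontrivial elements of conjugates of
`H`. Conversely, a representation whose character is constantly its degree on a cyclic group is
trivial there, so the kernel set lies in `N`. The order comes from inducing the indicator of `H \
{1}`. -/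

/-- The bilinear pairing `|G|⁻¹ ∑ g, f₁ g * f₂ g⁻¹` on complex functions on a finite group. -/
noncomputable def classPairing {G : Type*} [Group G] [Fintype G] (f₁ f₂ : G → ℂ) : ℂ :=
  (Nat.card G : ℂ)⁻¹ * ∑ g : G, f₁ g * f₂ g⁻¹

/-- The character of a matrix representation. -/
noncomputable def matrixCharacter {G : Type*} [Group G] {n : ℕ}
    (ρ : G →* Matrix (Fin n) (Fin n) ℂ) (g : G) : ℂ :=
  (ρ g).trace

/-! ### Irreducible characters from the Wedderburn decomposition -/

section MonoidAlgebra

variable {G : Type*} [Group G]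

theorem MonoidAlgebra.trace_mulLeft [Fintype G] (x : MonoidAlgebra ℂ G) :
    LinearMap.trace ℂ _ (LinearMap.mulLeft ℂ x) = Nat.card G * x.coeff 1 := by
  classical
  have hb (g : G) : MonoidAlgebra.basis G ℂ g = MonoidAlgebra.single g 1 := rfl
  have hr (y : MonoidAlgebra ℂ G) (g : G) : (MonoidAlgebra.basis G ℂ).repr y g = y.coeff g := rfl
  rw [LinearMap.trace_eq_matrix_trace ℂ (MonoidAlgebra.basis G ℂ), Matrix.trace]
  simp only [Matrix.diag_apply, LinearMap.toMatrix_apply, LinearMap.mulLeft_apply, hb, hr]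
  simp [MonoidAlgebra.coeff_mul_single_apply]

theorem Matrix.trace_mulLeft_pi {m : ℕ} {n : Fin m → ℕ}
    (y : ∀ i, Matrix (Fin (n i)) (Fin (n i)) ℂ) :
    LinearMap.trace ℂ _ (LinearMap.mulLeft ℂ y) = ∑ i, n i * (y i).trace := by
  classical
  rw [LinearMap.trace_eq_matrix_trace ℂ
    (Pi.basis fun i ↦ Matrix.stdBasis ℂ (Fin (n i)) (Fin (n i))), Matrix.trace,
    Fintype.sum_sigma]
  refine Finset.sum_congr rfl fun i _ ↦ ?_
  rw [Fintype.sum_prod_type]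
  simp only [Matrix.diag_apply, LinearMap.toMatrix_apply, LinearMap.mulLeft_apply, Pi.basis_apply,
    Pi.basis_repr, Matrix.stdBasis_eq_single, Pi.mul_apply, Pi.single_eq_same]
  simp [Matrix.trace, Matrix.stdBasis, Matrix.mul_apply, Matrix.single_apply, Finset.mul_sum]

theorem Matrix.exists_eq_smul_one_of_forall_commute {n : ℕ} {M : Matrix (Fin n) (Fin n) ℂ}
    (h : ∀ N, Commute N M) : ∃ c : ℂ, M = c • 1 := by
  obtain ⟨c, hc⟩ := Matrix.mem_range_scalar_of_commute_single (M := M) fun i j _ ↦ h _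
  exact ⟨c, by rw [← hc]; ext; simp [Matrix.one_apply, Matrix.diagonal]⟩

end MonoidAlgebra

/-- The representations are the blocks of the semisimple algebra `ℂ[G]`. The expansion of class
functions comes from computing the trace of the regular representation in two ways. -/
theorem exists_irreducible_matrix_representations (G : Type*) [Group G] [Fintype G] :
    ∃ (m : ℕ) (n : Fin m → ℕ) (ρ : ∀ i, G →* Matrix (Fin (n i)) (Fin (n i)) ℂ),
      (∀ i, classPairing (matrixCharacter (ρ i)) (matrixCharacter (ρ i)) = 1) ∧
      (∀ θ : G → ℂ, (∀ g h, θ (g * h) = θ (h * g)) → ∀ g, θ g =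
        ∑ i, classPairing θ (matrixCharacter (ρ i)) * matrixCharacter (ρ i) g) ∧
      ∀ g, (∀ i, ρ i g = 1) → g = 1 := by
  classical
  obtain ⟨m, n, hn, ⟨e⟩⟩ :=
    IsSemisimpleRing.exists_algEquiv_pi_matrix_of_isAlgClosed ℂ (MonoidAlgebra ℂ G)
  let ev (i : Fin m) : (∀ i, Matrix (Fin (n i)) (Fin (n i)) ℂ) →* Matrix (Fin (n i)) (Fin (n i)) ℂ :=
    Pi.evalMonoidHom _ i
  let ρ (i : Fin m) : G →* Matrix (Fin (n i)) (Fin (n i)) ℂ :=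
    (ev i).comp ((e : MonoidAlgebra ℂ G →* _).comp (MonoidAlgebra.of ℂ G))
  have hρ (i g) : ρ i g = e (MonoidAlgebra.of ℂ G g) i := rfl
  have hcard : (Nat.card G : ℂ) ≠ 0 := by exact_mod_cast Nat.card_pos.ne'
  have hcoeff (x : MonoidAlgebra ℂ G) :
      Nat.card G * x.coeff 1 = ∑ i, n i * (e x i).trace := by
    rw [← MonoidAlgebra.trace_mulLeft, ← Matrix.trace_mulLeft_pi,
      ← LinearMap.trace_conj' _ e.toLinearEquiv]
    congr 1
    refine LinearMap.ext fun y ↦ ?_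
    simp [LinearEquiv.conj_apply]
  have hexp (θ : G → ℂ) (hθ : ∀ g h, θ (g * h) = θ (h * g)) (g : G) : θ g =
      ∑ i, classPairing θ (matrixCharacter (ρ i)) * matrixCharacter (ρ i) g := by
    -- This element is central because `θ` is a class function, so it is scalar on each block; the
    -- coefficient of 1 in `z * g` recovers `θ g`.
    set z : MonoidAlgebra ℂ G := ∑ h : G, θ h • MonoidAlgebra.of ℂ G h⁻¹ with hz
    have hzcomm (x : MonoidAlgebra ℂ G) : Commute x z := by
      induction x using MonoidAlgebra.induction_on with
      | of k =>
        rw [Commute, SemiconjBy, hz, Finset.mul_sum, Finset.sum_mul,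
          ← Equiv.sum_comp (MulAut.conj k⁻¹).toEquiv]
        refine Finset.sum_congr rfl fun h _ ↦ ?_
        have h1 : θ (k⁻¹ * h * k⁻¹⁻¹) = θ h := by rw [hθ]; simp
        simp only [MulEquiv.toEquiv_eq_coe, EquivLike.coe_coe, MulAut.conj_apply, h1]
        simp [mul_assoc]
      | add a b ha hb => exact ha.add_left hb
      | smul r a ha => exact ha.smul_left r
    have hscalar (i) : ∃ c : ℂ, e z i = c • 1 :=
      Matrix.exists_eq_smul_one_of_forall_commute fun N ↦ by
        have := congrFun (((hzcomm (e.symm (Pi.single i N))).map e).eq) i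
        simpa [Commute, SemiconjBy] using this
    choose c hc using hscalar
    have htr (i) : n i * c i = Nat.card G * classPairing θ (matrixCharacter (ρ i)) := by
      have h1 : (e z i).trace = n i * c i := by simp [hc, mul_comm]
      rw [← h1, classPairing, mul_inv_cancel_left₀ hcard, hz]
      simp only [matrixCharacter, hρ, map_sum, map_smul, Finset.sum_apply, Pi.smul_apply,
        Matrix.trace_sum, Matrix.trace_smul, smul_eq_mul]
    have h1 : (z * MonoidAlgebra.of ℂ G g).coeff 1 = θ g := by
      simp [hz, Finset.sum_mul, Finsupp.single_apply, inv_mul_eq_one]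
    have h2 := hcoeff (z * MonoidAlgebra.of ℂ G g)
    rw [h1] at h2
    apply mul_left_cancel₀ hcard
    rw [h2, Finset.mul_sum]
    refine Finset.sum_congr rfl fun i _ ↦ ?_
    rw [map_mul, Pi.mul_apply, hc, ← mul_assoc, ← htr, matrixCharacter, hρ]
    simp [mul_assoc]
  refine ⟨m, n, ρ, fun i ↦ ?_, hexp, fun g hg ↦ ?_⟩
  · have := hn i
    -- A trace-one element supported in block `i`: applied to the expansion of the `i`-th character,
    -- it isolates that character's norm.
    set y : ∀ i, Matrix (Fin (n i)) (Fin (n i)) ℂ := Pi.single i (Matrix.single 0 0 1) with hy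
    have htr (j) : (y j).trace = ∑ g, (e.symm y).coeff g * matrixCharacter (ρ j) g := by
      have h1 : e.symm y = ∑ g, (e.symm y).coeff g • MonoidAlgebra.of ℂ G g := by
        ext g
        simp
      have h2 := congrArg (fun x ↦ (e x j).trace) h1
      simpa only [AlgEquiv.apply_symm_apply, matrixCharacter, hρ, map_sum, map_smul,
        Finset.sum_apply, Pi.smul_apply, Matrix.trace_sum, Matrix.trace_smul, smul_eq_mul] using h2
    have h3 : ∑ g, (e.symm y).coeff g * matrixCharacter (ρ i) g =
        ∑ j, classPairing (matrixCharacter (ρ i)) (matrixCharacter (ρ j)) * (y j).trace := by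
      simp_rw [htr, Finset.mul_sum]
      rw [Finset.sum_comm]
      refine Finset.sum_congr rfl fun g _ ↦ ?_
      rw [hexp (matrixCharacter (ρ i)) (fun a b ↦ ?_) g, Finset.mul_sum]
      · refine Finset.sum_congr rfl fun j _ ↦ ?_
        ring
      · rw [matrixCharacter, matrixCharacter, map_mul, map_mul, Matrix.trace_mul_comm]
    rw [← htr, Finset.sum_eq_single i] at h3
    · simpa [hy] using h3.symm
    · intro j _ hj
      simp [hy, hj]
    · simp
  · apply MonoidAlgebra.of_injective (R := ℂ)
    apply e.injective
    ext1 i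
    rw [map_one, map_one, ← hρ, hg, Pi.one_apply]

/-! ### Characters of matrix representations -/

section MatrixCharacter

variable {G : Type*} [Group G]

theorem matrixCharacter_one {n : ℕ} (ρ : G →* Matrix (Fin n) (Fin n) ℂ) :
    matrixCharacter ρ 1 = n := by
  simp [matrixCharacter]

theorem matrixCharacter_mul_comm {n : ℕ} (ρ : G →* Matrix (Fin n) (Fin n) ℂ) (g h : G) :
    matrixCharacter ρ (g * h) = matrixCharacter ρ (h * g) := by
  rw [matrixCharacter, matrixCharacter, map_mul, map_mul, Matrix.trace_mul_comm]

/-- The linear representation on `Fin n → ℂ` given by a matrix representation. -/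
noncomputable def matrixRepresentation {n : ℕ} (ρ : G →* Matrix (Fin n) (Fin n) ℂ) :
    Representation ℂ G (Fin n → ℂ) :=
  (Matrix.toLinAlgEquiv' (R := ℂ) (n := Fin n) : _ →* _).comp ρ

theorem matrixRepresentation_character {n : ℕ} (ρ : G →* Matrix (Fin n) (Fin n) ℂ) (g : G) :
    (matrixRepresentation ρ).character g = matrixCharacter ρ g :=
  Matrix.trace_toLin'_eq (ρ g)

theorem exists_classPairing_matrixCharacter_eq_natCast [Fintype G] {m n : ℕ}
    (ρ : G →* Matrix (Fin m) (Fin m) ℂ) (σ : G →* Matrix (Fin n) (Fin n) ℂ) :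
    ∃ k : ℕ, classPairing (matrixCharacter ρ) (matrixCharacter σ) = k := by
  have : Invertible (Nat.card G : ℂ) := invertibleOfNonzero (by exact_mod_cast Nat.card_pos.ne')
  have h := Representation.card_inv_mul_sum_char_mul_char_eq_finrank
    (matrixRepresentation σ) (matrixRepresentation ρ)
  simp only [matrixRepresentation_character] at h
  exact ⟨_, h⟩

/-- Averaging the character over `⟨g⟩` gives the dimension of the fixed space, here `n`, so every
vector is fixed. -/
theorem map_eq_one_of_forall_matrixCharacter_zpow_eq [Finite G] {n : ℕ}
    (ρ : G →* Matrix (Fin n) (Fin n) ℂ) (g : G)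
    (h : ∀ k : ℤ, matrixCharacter ρ (g ^ k) = n) : ρ g = 1 := by
  have := Fintype.ofFinite (Subgroup.zpowers g)
  have hne : (Nat.card (Subgroup.zpowers g) : ℂ) ≠ 0 := by exact_mod_cast Nat.card_pos.ne'
  have : Invertible (Nat.card (Subgroup.zpowers g) : ℂ) := invertibleOfNonzero hne
  set τ := matrixRepresentation (ρ.comp (Subgroup.zpowers g).subtype) with hτ
  have h1 := Representation.card_inv_mul_sum_char_eq_finrank τ
  have h2 (x : Subgroup.zpowers g) : τ.character x = n := by
    obtain ⟨_, k, rfl⟩ := x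
    rw [hτ, matrixRepresentation_character]
    exact h k
  simp only [h2, Finset.sum_const, Finset.card_univ, nsmul_eq_mul, ← Nat.card_eq_fintype_card] at h1
  rw [inv_mul_cancel_left₀ hne, Nat.cast_inj] at h1
  have h3 : τ.invariants = ⊤ := Submodule.eq_top_of_finrank_eq (by simp [← h1])
  apply (Matrix.toLinAlgEquiv' (R := ℂ) (n := Fin n)).injective
  refine LinearMap.ext fun v ↦ ?_
  have h4 : v ∈ τ.invariants := h3 ▸ Submodule.mem_top
  simpa [hτ, matrixRepresentation] using h4 ⟨g, Subgroup.mem_zpowers g⟩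

end MatrixCharacter

section ClassPairing

variable {G : Type*} [Group G] [Fintype G]

theorem classPairing_comm (f₁ f₂ : G → ℂ) : classPairing f₁ f₂ = classPairing f₂ f₁ := by
  rw [classPairing, classPairing, ← Equiv.sum_comp (Equiv.inv G)]
  simp [mul_comm]

theorem classPairing_add_left (f₁ f₂ f : G → ℂ) :
    classPairing (fun g ↦ f₁ g + f₂ g) f = classPairing f₁ f + classPairing f₂ f := by
  simp only [classPairing, add_mul, Finset.sum_add_distrib, mul_add]

theorem classPairing_mul_left (c : ℂ) (f₁ f : G → ℂ) :
    classPairing (fun g ↦ c * f₁ g) f = c * classPairing f₁ f := by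
  simp only [classPairing, mul_assoc, ← Finset.mul_sum]
  ring

theorem classPairing_sum_left {ι : Type*} (s : Finset ι) (F : ι → G → ℂ) (f : G → ℂ) :
    classPairing (fun g ↦ ∑ i ∈ s, F i g) f = ∑ i ∈ s, classPairing (F i) f := by
  simp only [classPairing, Finset.sum_mul, ← Finset.mul_sum]
  rw [Finset.sum_comm]

theorem classPairing_one_one : classPairing (fun _ : G ↦ 1) (fun _ ↦ 1) = 1 := by
  simp [classPairing]

end ClassPairing

section FrobeniusKernel

variable {G : Type*} [Group G] {H : Subgroup G}

theorem mem_conjSubgroup_iff {x g : G} : g ∈ conjSubgroup H x ↔ x * g * x⁻¹ ∈ H := by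
  constructor
  · rintro ⟨h, hh, rfl⟩
    simpa [mul_assoc] using hh
  · exact fun h ↦ ⟨_, h, by simp [mul_assoc]⟩

theorem mem_frobeniusKernel_iff {g : G} :
    g ∈ frobeniusKernel H ↔ (∀ x, x * g * x⁻¹ ∉ H) ∨ g = 1 := by
  simp [frobeniusKernel, mem_conjSubgroup_iff, or_comm]

theorem IsFrobeniusComplement.mem_of_conj_mem (hH : IsFrobeniusComplement H) {x h : G}
    (hh : h ∈ H) (h1 : h ≠ 1) (hx : x * h * x⁻¹ ∈ H) : x ∈ H := by
  by_contra hxH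
  have : h ∈ H ⊓ conjSubgroup H x := ⟨hh, mem_conjSubgroup_iff.2 hx⟩
  rw [hH.inf_conj_eq_bot x hxH] at this
  exact h1 (Subgroup.mem_bot.1 this)

end FrobeniusKernel

/-! ### Induction from `H` and Frobenius reciprocity -/

section Induced

variable {G : Type*} [Group G] [Fintype G] {H : Subgroup G}

open Classical in
/-- The function on `G` induced from a function on the subgroup `H`. -/
noncomputable def inducedFunction (f : H → ℂ) (g : G) : ℂ :=
  (Nat.card H : ℂ)⁻¹ * ∑ x : G, if hx : x * g * x⁻¹ ∈ H then f ⟨x * g * x⁻¹, hx⟩ else 0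

theorem inducedFunction_mul_comm (f : H → ℂ) (g h : G) :
    inducedFunction f (g * h) = inducedFunction f (h * g) := by
  rw [inducedFunction, inducedFunction, ← Equiv.sum_comp (Equiv.mulRight h)]
  congr 1
  refine Finset.sum_congr rfl fun x _ ↦ ?_
  have : x * h * (g * h) * (x * h)⁻¹ = x * (h * g) * x⁻¹ := by group
  rw [Equiv.coe_mulRight]
  generalize x * h * (g * h) * (x * h)⁻¹ = y at this
  subst this
  rfl

theorem classPairing_inducedFunction [Fintype H] (f : H → ℂ) (F : G → ℂ)
    (hF : ∀ g h, F (g * h) = F (h * g)) :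
    classPairing (inducedFunction f) F = classPairing f fun h ↦ F h := by
  classical
  have hcard : (Nat.card G : ℂ) ≠ 0 := by exact_mod_cast Nat.card_pos.ne'
  set φ : G → ℂ := fun y ↦ if hy : y ∈ H then f ⟨y, hy⟩ else 0 with hφ
  have h1 : ∑ g, inducedFunction f g * F g⁻¹ =
      (Nat.card H : ℂ)⁻¹ * ∑ x : G, ∑ g, φ (x * g * x⁻¹) * F g⁻¹ := by
    rw [Finset.sum_comm, Finset.mul_sum]
    refine Finset.sum_congr rfl fun g _ ↦ ?_
    rw [inducedFunction, mul_assoc, Finset.sum_mul]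
  have h2 (x : G) : ∑ g, φ (x * g * x⁻¹) * F g⁻¹ = ∑ g, φ g * F g⁻¹ := by
    rw [← Equiv.sum_comp (MulAut.conj x).toEquiv fun g ↦ φ g * F g⁻¹]
    refine Finset.sum_congr rfl fun g _ ↦ ?_
    have : F (x * g * x⁻¹)⁻¹ = F g⁻¹ := by
      rw [mul_inv_rev, hF]; simp
    simp only [MulEquiv.toEquiv_eq_coe, EquivLike.coe_coe, MulAut.conj_apply, this]
  have h3 : ∑ g, φ g * F g⁻¹ = ∑ h : H, f h * F (h : G)⁻¹ := by
    have h4 : ∑ g ∈ Finset.univ.filter (· ∈ H), φ g * F g⁻¹ = ∑ g, φ g * F g⁻¹ := by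
      refine Finset.sum_subset (Finset.subset_univ _) fun g _ hg ↦ ?_
      simp only [Finset.mem_filter, Finset.mem_univ, true_and] at hg
      simp [hφ, hg]
    rw [← h4, Finset.sum_subtype (p := (· ∈ H)) _ (by simp)]
    refine Finset.sum_congr rfl fun h _ ↦ ?_
    simp [hφ]
  rw [classPairing, h1]
  simp only [h2, h3, Finset.sum_const, Finset.card_univ, nsmul_eq_mul, ← Nat.card_eq_fintype_card]
  rw [mul_left_comm, inv_mul_cancel_left₀ hcard, classPairing]
  simp

theorem inducedFunction_eq_zero_of_mem_frobeniusKernel (f : H → ℂ) (hf : f 1 = 0) {g : G}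
    (hg : g ∈ frobeniusKernel H) : inducedFunction f g = 0 := by
  rw [inducedFunction, Finset.sum_eq_zero, mul_zero]
  intro x _
  split_ifs with hx
  · rcases mem_frobeniusKernel_iff.1 hg with h | rfl
    · exact absurd hx (h x)
    · convert hf using 2
      ext; simp
  · rfl

theorem IsFrobeniusComplement.inducedFunction_apply_coe (hH : IsFrobeniusComplement H)
    (f : H → ℂ) (hf : f 1 = 0) (hcomm : ∀ a b, f (a * b) = f (b * a)) (h : H) :
    inducedFunction f h = f h := by
  classical
  by_cases h1 : h = 1
  · rw [h1, hf]
    exact inducedFunction_eq_zero_of_mem_frobeniusKernel f hf (mem_frobeniusKernel_iff.2 (.inr rfl))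
  have hcard : (Nat.card H : ℂ) ≠ 0 := by exact_mod_cast Nat.card_pos.ne'
  -- For `h ≠ 1`, the complement condition leaves only conjugators `x ∈ H`.
  have key (x : G) : (if hx : x * h * x⁻¹ ∈ H then f ⟨x * h * x⁻¹, hx⟩ else 0) =
      if x ∈ H then f h else 0 := by
    by_cases hx : x ∈ H
    · have hx' : x * h * x⁻¹ ∈ H := H.mul_mem (H.mul_mem hx h.2) (H.inv_mem hx)
      rw [dif_pos hx', if_pos hx]
      have : (⟨x * h * x⁻¹, hx'⟩ : H) = ⟨x, hx⟩ * (h * ⟨x, hx⟩⁻¹) := by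
        ext; simp [mul_assoc]
      rw [this, hcomm, inv_mul_cancel_right]
    · rw [if_neg hx, dif_neg]
      exact fun h' ↦ hx (hH.mem_of_conj_mem h.2 (by simpa using h1) h')
  rw [inducedFunction, Finset.sum_congr rfl fun x _ ↦ key x, ← Finset.sum_filter,
    Finset.sum_const, nsmul_eq_mul]
  have : (Finset.univ.filter (· ∈ H)).card = Nat.card H := by
    rw [Nat.card_eq_fintype_card, Fintype.card_subtype]
  rw [this, inv_mul_cancel_left₀ hcard]

end Induced

/-! ### Extending characters and counting the kernel -/

section FrobeniusKernel

variable {G : Type*} [Group G] {H : Subgroup G}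

theorem IsFrobeniusComplement.zpow_mem_frobeniusKernel (hH : IsFrobeniusComplement H) {g : G}
    (hg : g ∈ frobeniusKernel H) (k : ℤ) : g ^ k ∈ frobeniusKernel H := by
  rw [mem_frobeniusKernel_iff] at hg ⊢
  rcases hg with hg | rfl
  · by_contra! h
    obtain ⟨⟨x, hx⟩, h1⟩ := h
    refine hg x (hH.mem_of_conj_mem hx ?_ ?_)
    · simpa [mul_inv_eq_one] using h1
    -- A conjugate of `g` commutes with its own power, a nontrivial element of `H`.
    · have : x * g * x⁻¹ * (x * g ^ k * x⁻¹) * (x * g * x⁻¹)⁻¹ = x * g ^ k * x⁻¹ := by group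
      rwa [this]
  · simp

theorem IsFrobeniusComplement.exists_extension [Fintype G] [Fintype H]
    (hH : IsFrobeniusComplement H) {d : ℕ} (ρ : H →* Matrix (Fin d) (Fin d) ℂ)
    (hρ : classPairing (matrixCharacter ρ) (matrixCharacter ρ) = 1) :
    ∃ σ : G →* Matrix (Fin d) (Fin d) ℂ, (∀ h : H, matrixCharacter σ h = matrixCharacter ρ h) ∧
      ∀ g ∈ frobeniusKernel H, matrixCharacter σ g = d := by
  set χ := matrixCharacter ρ with hχ
  set f : H → ℂ := fun h ↦ χ h + -d * 1 with hf
  have hf1 : f 1 = 0 := by simp [hf, hχ, matrixCharacter_one]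
  have hfc (a b : H) : f (a * b) = f (b * a) := by
    simp only [hf, hχ, matrixCharacter_mul_comm ρ a b]
  set θ : G → ℂ := fun g ↦ d * 1 + inducedFunction f g with hθ
  have hθc (a b : G) : θ (a * b) = θ (b * a) := by
    simp only [hθ, inducedFunction_mul_comm f a b]
  have hθH (h : H) : θ h = χ h := by
    simp only [hθ, hH.inducedFunction_apply_coe f hf1 hfc]
    simp [hf]
  have hθK {g : G} (hg : g ∈ frobeniusKernel H) : θ g = d := by
    simp [hθ, inducedFunction_eq_zero_of_mem_frobeniusKernel f hf1 hg]
  have hpair (F : G → ℂ) (hF : ∀ a b, F (a * b) = F (b * a)) : classPairing θ F =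
      d * classPairing (fun _ ↦ 1) F + (classPairing χ (fun h ↦ F h) +
        -d * classPairing (fun _ ↦ 1) fun h : H ↦ F h) := by
    rw [hθ, classPairing_add_left, classPairing_mul_left, classPairing_inducedFunction f F hF, hf,
      classPairing_add_left, classPairing_mul_left]
  -- Since `⟨θ, 1⟩ = ⟨χ, 1⟩`, the terms in `d` cancel and leave `⟨χ, χ⟩`.
  have hθθ : classPairing θ θ = 1 := by
    have h1 := hpair (fun _ ↦ 1) fun _ _ ↦ rfl
    rw [hpair θ hθc, classPairing_comm _ θ, h1]
    simp only [hθH]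
    change _ + (classPairing χ χ + -d * classPairing _ χ) = 1
    rw [classPairing_comm (fun _ : H ↦ 1) χ, hρ, classPairing_one_one, classPairing_one_one]
    ring
  obtain ⟨m, n, τ, -, hexp, -⟩ := exists_irreducible_matrix_representations G
  have htriv (K : Type _) [Group K] :
      matrixCharacter (1 : K →* Matrix (Fin 1) (Fin 1) ℂ) = fun _ ↦ 1 := by
    ext; simp [matrixCharacter]
  have hint (i) : ∃ a : ℤ, classPairing θ (matrixCharacter (τ i)) = a := by
    obtain ⟨a, ha⟩ := exists_classPairing_matrixCharacter_eq_natCast 1 (τ i)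
    obtain ⟨b, hb⟩ := exists_classPairing_matrixCharacter_eq_natCast ρ ((τ i).comp H.subtype)
    obtain ⟨c, hc⟩ := exists_classPairing_matrixCharacter_eq_natCast 1 ((τ i).comp H.subtype)
    rw [htriv] at ha hc
    have hres : matrixCharacter ((τ i).comp H.subtype) = fun h : H ↦ matrixCharacter (τ i) h := rfl
    rw [hres] at hb hc
    refine ⟨d * a + (b + -d * c), ?_⟩
    rw [hpair _ (matrixCharacter_mul_comm _), ha, hb, hc]
    push_cast
    ring
  choose a ha using hint
  have hsum (g : G) : θ g = ∑ i, a i * matrixCharacter (τ i) g := by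
    rw [hexp θ hθc g]
    simp only [ha]
  have hsq : ∑ i, a i * a i = 1 := by
    have : classPairing θ θ = ∑ i, (a i : ℂ) * a i := by
      conv_lhs => enter [1]; rw [funext hsum]
      rw [classPairing_sum_left]
      refine Finset.sum_congr rfl fun i _ ↦ ?_
      rw [classPairing_mul_left, classPairing_comm, ha]
    rw [hθθ] at this
    exact_mod_cast this.symm
  obtain ⟨i, hi⟩ : ∃ i, a i ≠ 0 := by
    by_contra! h
    simp [h] at hsq
  have hsplit := Finset.add_sum_erase Finset.univ (fun j ↦ a j * a j) (Finset.mem_univ i)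
  have hnonneg : ∀ j ∈ Finset.univ.erase i, 0 ≤ a j * a j := fun j _ ↦ mul_self_nonneg _
  have hpos : 0 < a i * a i := mul_self_pos.2 hi
  have hrest : ∑ j ∈ Finset.univ.erase i, a j * a j = 0 := by
    have := Finset.sum_nonneg hnonneg
    omega
  have hone : a i * a i = 1 := by omega
  have hzero (j) (hj : j ≠ i) : a j = 0 := by
    simpa using (Finset.sum_eq_zero_iff_of_nonneg hnonneg).1 hrest j (by simp [hj])
  have hθi (g : G) : θ g = a i * matrixCharacter (τ i) g := by
    rw [hsum, Finset.sum_eq_single i (fun j _ hj ↦ by simp [hzero j hj]) (by simp)]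
  -- Positivity of `d` is what excludes `a i = -1`.
  have hd : d ≠ 0 := by
    rintro rfl
    have : χ = fun _ ↦ 0 := by ext; simp [hχ, matrixCharacter]
    simp [this, classPairing] at hρ
  have hdn : (d : ℤ) = a i * n i := by
    have h1 := hθi 1
    rw [hθK (mem_frobeniusKernel_iff.2 (.inr rfl)), matrixCharacter_one] at h1
    exact_mod_cast h1
  have hai : a i = 1 := by
    rcases mul_self_eq_one_iff.1 hone with h | h
    · exact h
    · rw [h] at hdn
      omega
  have hni : n i = d := by
    rw [hai] at hdn
    omega
  have hθτ (g : G) : matrixCharacter (τ i) g = θ g := by simp [hθi, hai]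
  clear_value χ θ
  clear hexp hsum ha hθi hdn
  obtain ⟨σ, hσ⟩ : ∃ σ : G →* Matrix (Fin d) (Fin d) ℂ, ∀ g, matrixCharacter σ g = θ g := by
    rw [← hni]
    exact ⟨τ i, hθτ⟩
  exact ⟨σ, fun h ↦ (hσ h).trans (hθH h), fun g hg ↦ (hσ g).trans (hθK hg)⟩

theorem IsFrobeniusComplement.card_frobeniusKernel [Finite G] (hH : IsFrobeniusComplement H) :
    Nat.card (frobeniusKernel H) = H.index := by
  classical
  have := Fintype.ofFinite G
  have hG0 : (Nat.card G : ℂ) ≠ 0 := by exact_mod_cast Nat.card_pos.ne'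
  have hH0 : (Nat.card H : ℂ) ≠ 0 := by exact_mod_cast Nat.card_pos.ne'
  set f : H → ℂ := fun h ↦ if h = 1 then 0 else 1 with hf
  have hf1 : f 1 = 0 := by simp [hf]
  have hfc (a b : H) : f (a * b) = f (b * a) := by
    have : a * b = 1 ↔ b * a = 1 := by rw [mul_eq_one_iff_eq_inv, mul_eq_one_iff_inv_eq, eq_comm]
    simp [hf, this]
  have hind (g : G) : inducedFunction f g = 1 - if g ∈ frobeniusKernel H then 1 else 0 := by
    split_ifs with hg
    · simp [inducedFunction_eq_zero_of_mem_frobeniusKernel f hf1 hg]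
    · rw [mem_frobeniusKernel_iff] at hg
      push Not at hg
      obtain ⟨⟨x, hx⟩, h1⟩ := hg
      have h2 : inducedFunction f g = inducedFunction f (x * g * x⁻¹) := by
        rw [mul_assoc, inducedFunction_mul_comm f x, inv_mul_cancel_right]
      have h3 := hH.inducedFunction_apply_coe f hf1 hfc ⟨_, hx⟩
      rw [h2, h3]
      simp only [hf, sub_zero]
      exact if_neg fun h ↦ h1 (conj_eq_one_iff.1 (congrArg Subtype.val h))
  have hfH : ∑ h, f h = Nat.card H - 1 := by
    have (h : H) : f h = 1 - if h = 1 then 1 else 0 := by simp only [hf]; split_ifs <;> simp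
    simp [this]
  -- Reciprocity against the constant 1 gives `(|G| - |K|) / |G| = (|H| - 1) / |H|`.
  have key := classPairing_inducedFunction f (fun _ ↦ 1) fun _ _ ↦ rfl
  simp only [classPairing, mul_one, hind, hfH, Finset.sum_sub_distrib, Finset.sum_boole] at key
  have hK : (Finset.univ.filter (· ∈ frobeniusKernel H)).card = Nat.card (frobeniusKernel H) := by
    rw [Nat.card_eq_fintype_card, Fintype.card_subtype]
  rw [hK] at key
  have hmul : (Nat.card H * H.index : ℂ) = Nat.card G := by exact_mod_cast H.card_mul_index
  simp only [Finset.sum_const, Finset.card_univ, nsmul_eq_mul, mul_one,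
    ← Nat.card_eq_fintype_card] at key
  field_simp at key
  have : (Nat.card H : ℂ) * Nat.card (frobeniusKernel H) = Nat.card H * H.index := by
    rw [hmul]
    linear_combination -key
  exact_mod_cast mul_left_cancel₀ hH0 this

end FrobeniusKernel

theorem mainTheorem2 {G : Type*} [Group G] [Finite G] (H : Subgroup G)
    (hH : IsFrobeniusComplement H) (n : ℕ) (hn : H.index = n) :
    ∃ K : Subgroup G, (K : Set G) = frobeniusKernel H ∧ K.Normal ∧ Nat.card K = n := by
  have := Fintype.ofFinite G
  have := Fintype.ofFinite H
  obtain ⟨m, d, ρ, hρ, -, hsep⟩ := exists_irreducible_matrix_representations H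
  choose σ hσH hσK using fun i ↦ hH.exists_extension (ρ i) (hρ i)
  set N : Subgroup G := ⨅ i, (σ i).ker with hN
  have hNn : N.Normal := Subgroup.normal_iInf_normal fun i ↦ (σ i).normal_ker
  have hmem {g : G} : g ∈ N ↔ ∀ i, σ i g = 1 := by simp [hN, Subgroup.mem_iInf]
  have hNH (g : G) (hg : g ∈ N) (hgH : g ∈ H) : g = 1 := by
    refine congrArg Subtype.val (hsep ⟨g, hgH⟩ fun i ↦ ?_)
    refine map_eq_one_of_forall_matrixCharacter_zpow_eq _ _ fun k ↦ ?_
    rw [← hσH, matrixCharacter, Subgroup.coe_zpow, hmem.1 (N.zpow_mem hg k) i]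
    simp
  have hNK : (N : Set G) = frobeniusKernel H := by
    ext g
    rw [SetLike.mem_coe]
    constructor
    · intro hg
      rw [mem_frobeniusKernel_iff]
      by_cases h : ∃ x, x * g * x⁻¹ ∈ H
      · obtain ⟨x, hx⟩ := h
        exact .inr (conj_eq_one_iff.1 (hNH _ (hNn.conj_mem g hg x) hx))
      · exact .inl (not_exists.1 h)
    · exact fun hg ↦ hmem.2 fun i ↦ map_eq_one_of_forall_matrixCharacter_zpow_eq _ _ fun k ↦
        hσK i _ (hH.zpow_mem_frobeniusKernel hg k)
  refine ⟨N, hNK, hNn, ?_⟩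
  rw [← hn, ← hH.card_frobeniusKernel, ← hNK]
  rfl
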